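/- Let $G$ be a finite group and let $\alpha$ be an automorphism of $G$. Then the following statements are equivalent: (1) $\alpha$ is inner, i.e. there is $g\in G$ with $\alpha(x)=gxg^{-1}$ for all $x\in G$. (2) $\alpha$ extends to every finite group containing $G$, i.e. for every finite group $H$ and every injective homomorphism $\iota:G\to H$ there is an automorphism $\beta$ of $H$ with $\beta(\iota(x))=\iota(\alpha(x))$ for all $x\in G$. (3) $\alpha$ lifts to every finite group $\hat G$ such that $\hat G/N\cong G$ for some characteristic subgroup $N\le\hat G$, i.e. for every finite group $\hat G$, every characteristic subgroup $N$ of $\hat G$ and every isomorphism $\varphi:\hat G/N\to G$ there is an automorphism $\beta$ of $\hat G$ with $\varphi(\beta(x)N)=\alpha(\varphi(xN))$ for all $x\in\hat G$. -/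

import Mathlib

universe u

/-- The automorphism `α` of `G` is inner: it is conjugation by some element of `G`. -/
def IsInnerAut {G : Type*} [Group G] (α : G ≃* G) : Prop :=
  ∃ g : G, ∀ x : G, α x = g * x * g⁻¹

/-- Given an embedding `ι` of `G` into `H` (used for injective `ι`, so that `G` is identified
with a subgroup of `H`), the automorphism `α` of `G` extends to an automorphism of `H`. -/
def ExtendsAlong {G H : Type*} [Group G] [Group H] (α : G ≃* G) (ι : G →* H) : Prop :=
  ∃ β : H ≃* H, ∀ x : G, β (ι x) = ι (α x)

/-- Given an identification `φ` of the quotient `K ⧸ N` with `G`, the automorphism `α` of `G`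
lifts to an automorphism `β` of `K`: on `K ⧸ N`, identified with `G`, `β` induces `α`. -/
def LiftsAlong {G K : Type*} [Group G] [Group K] (α : G ≃* G)
    (N : Subgroup K) [N.Normal] (φ : K ⧸ N ≃* G) : Prop :=
  ∃ β : K ≃* K, ∀ x : K, φ (QuotientGroup.mk (β x)) = α (φ (QuotientGroup.mk x))

/-! Inner automorphisms plainly extend and lift. Conversely, one finite split extension `H = M ⋊ (V
⋊ G)`, all of whose automorphisms induce inner automorphisms on `G`, settles both other conditions.
Here `V` is a space over `ZMod q` with a basis of two copies of `G` (the points), and `M` has one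
coordinate over `ZMod (p c)` for each pair `(c, x)`, on which `V` acts through a linear form: a
point, or the sum of the endpoints of a coloured Cayley edge. The primes are distinct and prime to
the order of `G`, so automorphisms preserve the kernel of `proj` and each colour. Comparing
centralizers, they permute the kernels of the point forms (`exists_map_v_eq_zero_iff`) and respect
coloured edges. A colour-preserving symmetry of a Cayley graph is a left translation by some `t`,
and `t` is the conjugator (`exists_map_g_eq_conj`). -/

/-- The linear forms on `Bool → G → ZMod q` attached to the points and to the coloured edges
`(x, x * c)` of the Cayley graph of `G`. -/
def cayleyForm {G : Type u} [Group G] {q : ℕ} (v : Bool → G → ZMod q) :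
    Bool ⊕ G → G → ZMod q
  | Sum.inl b, x => v b x
  | Sum.inr c, x => v false x + v true (x * c)

/-- The left translation action of `G` on `Bool → G → ZMod q`. -/
def leftShift {G : Type u} [Group G] {q : ℕ} (g : G) (v : Bool → G → ZMod q) :
    Bool → G → ZMod q := fun b x => v b (g⁻¹ * x)

section
variable {G : Type u} [Group G] {q : ℕ}

lemma cayleyForm_add (v w : Bool → G → ZMod q) (c : Bool ⊕ G) (x : G) :
    cayleyForm (v + w) c x = cayleyForm v c x + cayleyForm w c x := by
  rcases c with b | c
  · rfl
  · simp only [cayleyForm, Pi.add_apply]; ring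

lemma cayleyForm_zero (c : Bool ⊕ G) (x : G) :
    cayleyForm (0 : Bool → G → ZMod q) c x = 0 := by
  rcases c with b | c <;> simp [cayleyForm]

lemma cayleyForm_leftShift (g : G) (v : Bool → G → ZMod q) (c : Bool ⊕ G) (x : G) :
    cayleyForm (leftShift g v) c x = cayleyForm v c (g⁻¹ * x) := by
  rcases c with b | c <;> simp [cayleyForm, leftShift, mul_assoc]

lemma leftShift_add (g : G) (v w : Bool → G → ZMod q) :
    leftShift g (v + w) = leftShift g v + leftShift g w := rfl

lemma leftShift_mul (g h : G) (v : Bool → G → ZMod q) :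
    leftShift (g * h) v = leftShift g (leftShift h v) := by
  funext b x; simp [leftShift, mul_assoc]

lemma leftShift_one (v : Bool → G → ZMod q) : leftShift 1 v = v := by
  funext b x; simp [leftShift]

end

/-! ### The extension group -/

/-- The iterated semidirect product of `∏ c, (ZMod (p c))^G`, `(ZMod q)^(Bool × G)` and `G`, the
second factor acting on the first diagonally through the characters `χ c ∘ cayleyForm`. -/
@[ext]
structure CayleyCover {G : Type u} [Group G] {q : ℕ} {p : Bool ⊕ G → ℕ}
    (χ : ∀ c, Multiplicative (ZMod q) →* (ZMod (p c))ˣ) : Type u where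
  m : ∀ c, G → ZMod (p c)
  v : Bool → G → ZMod q
  g : G

namespace CayleyCover

section
variable {G : Type u} [Group G] {q : ℕ} {p : Bool ⊕ G → ℕ}
  (χ : ∀ c, Multiplicative (ZMod q) →* (ZMod (p c))ˣ)

/-- The scalar by which `v` acts on the coordinate `(c, x)`. -/
def weight (v : Bool → G → ZMod q) (c : Bool ⊕ G) (x : G) : ZMod (p c) :=
  (χ c (Multiplicative.ofAdd (cayleyForm v c x)) : (ZMod (p c))ˣ)

lemma weight_add (v w : Bool → G → ZMod q) (c : Bool ⊕ G) (x : G) :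
    weight χ (v + w) c x = weight χ v c x * weight χ w c x := by
  simp [weight, cayleyForm_add, ofAdd_add]

lemma weight_zero (c : Bool ⊕ G) (x : G) : weight χ 0 c x = 1 := by
  simp [weight, cayleyForm_zero]

lemma weight_leftShift (g : G) (v : Bool → G → ZMod q) (c : Bool ⊕ G) (x : G) :
    weight χ (leftShift g v) c x = weight χ v c (g⁻¹ * x) := by
  simp [weight, cayleyForm_leftShift]

variable {χ}

lemma weight_eq_one_iff (hχ : ∀ c, Function.Injective (χ c)) (v : Bool → G → ZMod q)
    (c : Bool ⊕ G) (x : G) : weight χ v c x = 1 ↔ cayleyForm v c x = 0 := by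
  rw [weight, Units.val_eq_one, map_eq_one_iff _ (hχ c), ofAdd_eq_one]

instance : Mul (CayleyCover χ) where
  mul a b :=
    { m := fun c x => a.m c x + weight χ a.v c x * b.m c (a.g⁻¹ * x)
      v := a.v + leftShift a.g b.v
      g := a.g * b.g }

instance : One (CayleyCover χ) where
  one := { m := 0, v := 0, g := 1 }

instance : Inv (CayleyCover χ) where
  inv a :=
    { m := fun c x => -(weight χ (-leftShift a.g⁻¹ a.v) c x * a.m c (a.g * x))
      v := -leftShift a.g⁻¹ a.v
      g := a.g⁻¹ }

@[simp] lemma mul_m (a b : CayleyCover χ) (c : Bool ⊕ G) (x : G) :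
    (a * b).m c x = a.m c x + weight χ a.v c x * b.m c (a.g⁻¹ * x) := rfl
@[simp] lemma mul_v (a b : CayleyCover χ) : (a * b).v = a.v + leftShift a.g b.v := rfl
@[simp] lemma mul_g (a b : CayleyCover χ) : (a * b).g = a.g * b.g := rfl
@[simp] lemma one_m (c : Bool ⊕ G) (x : G) : (1 : CayleyCover χ).m c x = 0 := rfl
@[simp] lemma one_v : (1 : CayleyCover χ).v = 0 := rfl
@[simp] lemma one_g : (1 : CayleyCover χ).g = 1 := rfl
@[simp] lemma inv_m (a : CayleyCover χ) (c : Bool ⊕ G) (x : G) :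
    a⁻¹.m c x = -(weight χ (-leftShift a.g⁻¹ a.v) c x * a.m c (a.g * x)) := rfl
@[simp] lemma inv_v (a : CayleyCover χ) : a⁻¹.v = -leftShift a.g⁻¹ a.v := rfl
@[simp] lemma inv_g (a : CayleyCover χ) : a⁻¹.g = a.g⁻¹ := rfl

instance : Group (CayleyCover χ) :=
  Group.ofLeftAxioms
    (fun a b d => by
      ext c x
      · simp only [mul_m, mul_v, mul_g, weight_add, weight_leftShift, mul_inv_rev, mul_assoc]
        ring
      · simp only [mul_v, mul_g, leftShift_mul, leftShift_add, add_assoc]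
      · simp only [mul_g, mul_assoc])
    (fun a => by
      ext c x
      · simp [weight_zero]
      · simp [leftShift_one]
      · simp)
    (fun a => by
      ext c x
      · simp
      · simp
      · simp)

instance [Finite G] [NeZero q] [∀ c, NeZero (p c)] : Finite (CayleyCover χ) :=
  Finite.of_injective
    (fun a : CayleyCover χ => ((a.m, a.v, a.g) : (∀ c, G → ZMod (p c)) × _ × G))
    (fun a b h => by
      simp only [Prod.mk.injEq] at h
      exact CayleyCover.ext h.1 h.2.1 h.2.2)

variable (χ) in
/-- The projection onto `G`. -/
def proj : CayleyCover χ →* G where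
  toFun := CayleyCover.g
  map_one' := rfl
  map_mul' _ _ := rfl

variable (χ) in
/-- The embedding of `G` as a complement of the kernel of `proj`. -/
def complement : G →* CayleyCover χ where
  toFun g := { m := 0, v := 0, g := g }
  map_one' := rfl
  map_mul' g h := by
    ext c x
    · simp
    · simp [leftShift]
    · rfl

@[simp] lemma proj_apply (a : CayleyCover χ) : proj χ a = a.g := rfl

lemma pow_g (a : CayleyCover χ) (n : ℕ) : (a ^ n).g = a.g ^ n := map_pow (proj χ) a n

lemma pow_v {a : CayleyCover χ} (ha : a.g = 1) (n : ℕ) : (a ^ n).v = n • a.v := by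
  induction n with
  | zero => simp
  | succ n ih => rw [pow_succ', mul_v, ih, ha, leftShift_one, succ_nsmul']

lemma pow_m {a : CayleyCover χ} (ha : a.g = 1) (hv : a.v = 0) (n : ℕ) (c : Bool ⊕ G) (x : G) :
    (a ^ n).m c x = n • a.m c x := by
  induction n with
  | zero => simp
  | succ n ih =>
    rw [pow_succ', mul_m, ha, hv, weight_zero, one_mul, inv_one, one_mul, ih, succ_nsmul']

/-- The element supported at the coordinate `(c, x)`. -/
noncomputable def basis (c : Bool ⊕ G) (x : G) : CayleyCover χ := by
  classical exact { m := Pi.single c (Pi.single x 1), v := 0, g := 1 }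

end

/-! ### Rigidity under automorphisms -/

/-- The arithmetic conditions under which `CayleyCover χ` has few automorphisms. -/
structure Admissible {G : Type u} [Group G] {q : ℕ} {p : Bool ⊕ G → ℕ}
    (χ : ∀ c, Multiplicative (ZMod q) →* (ZMod (p c))ˣ) : Prop where
  inj : ∀ c, Function.Injective (χ c)
  prime_q : q.Prime
  prime_p : ∀ c, (p c).Prime
  p_inj : Function.Injective p
  ne : ∀ c, p c ≠ q
  coprime_q : q.Coprime (Nat.card G)
  coprime_p : ∀ c, (p c).Coprime (Nat.card G)

namespace Admissible
variable {G : Type u} [Group G] {q : ℕ} {p : Bool ⊕ G → ℕ}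
  {χ : ∀ c, Multiplicative (ZMod q) →* (ZMod (p c))ˣ}

lemma _root_.eq_one_of_pow_of_coprime {A : Type*} [Group A] {a : A} {n k : ℕ} (h : a ^ n = 1)
    (h' : a ^ k = 1) (hnk : n.Coprime k) : a = 1 := by
  simpa [hnk] using (pow_gcd_eq_one (a := a)).2 ⟨h, h'⟩

lemma _root_.ZMod.eq_zero_of_nsmul_of_coprime {n k : ℕ} {a : ZMod k} (h : n • a = 0)
    (hnk : n.Coprime k) : a = 0 := by
  rw [nsmul_eq_mul] at h
  exact ((ZMod.isUnit_iff_coprime n k).2 hnk).mul_right_eq_zero.1 h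

/-- The elements of order dividing `p c`. -/
lemma pow_eq_one_iff (hχ : Admissible χ) (c : Bool ⊕ G) (a : CayleyCover χ) :
    a ^ p c = 1 ↔ a.g = 1 ∧ a.v = 0 ∧ ∀ d, d ≠ c → a.m d = 0 := by
  constructor
  · intro h
    have hg : a.g = 1 := eq_one_of_pow_of_coprime (by rw [← pow_g, h, one_g])
      (pow_card_eq_one' (x := a.g)) (hχ.coprime_p c)
    have hv : a.v = 0 := by
      funext b x
      refine ZMod.eq_zero_of_nsmul_of_coprime (n := p c) ?_
        ((Nat.coprime_primes (hχ.prime_p c) hχ.prime_q).2 (hχ.ne c))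
      have := congrArg (fun a => a.v b x) h
      simpa [pow_v hg] using this
    refine ⟨hg, hv, fun d hd => ?_⟩
    funext x
    refine ZMod.eq_zero_of_nsmul_of_coprime (n := p c) ?_
      ((Nat.coprime_primes (hχ.prime_p c) (hχ.prime_p d)).2 fun e => hd (hχ.p_inj e).symm)
    rw [← pow_m hg hv, h, one_m]
  · rintro ⟨hg, hv, hm⟩
    ext d x
    · rw [pow_m hg hv]
      by_cases hd : d = c
      · subst hd; simp
      · simp [hm d hd]
    · simp [pow_v hg, hv]
    · simp [pow_g, hg]

/-- A power equation is invariant under automorphisms, which makes the kernel of `proj`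
characteristic. The exponent `q * ∏ c, p c` kills that kernel and is prime to the order of `G`. -/
lemma g_eq_one_iff [Finite G] (hχ : Admissible χ) :
    ∃ e : ℕ, ∀ a : CayleyCover χ, a.g = 1 ↔ a ^ e = 1 := by
  classical
  have := Fintype.ofFinite G
  refine ⟨q * ∏ c, p c, fun a => ⟨fun hg => ?_, fun h => ?_⟩⟩
  · have hg' : (a ^ q).g = 1 := by simp [pow_g, hg]
    have hv' : (a ^ q).v = 0 := by
      rw [pow_v hg]; funext b x; simp
    rw [pow_mul]
    ext d x
    · rw [pow_m hg' hv', nsmul_eq_mul, one_m,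
        (ZMod.natCast_eq_zero_iff _ _).2 (Finset.dvd_prod_of_mem p (Finset.mem_univ d)), zero_mul]
    · simp [pow_v hg', hv']
    · simp [pow_g, hg]
  · exact eq_one_of_pow_of_coprime (by rw [← pow_g, h, one_g])
      (pow_card_eq_one' (x := a.g))
      (hχ.coprime_q.mul_left (Nat.Coprime.prod_left fun c _ => hχ.coprime_p c))

lemma map_g_eq_one_iff [Finite G] (hχ : Admissible χ) (β : CayleyCover χ ≃* CayleyCover χ)
    (a : CayleyCover χ) : (β a).g = 1 ↔ a.g = 1 := by
  obtain ⟨e, he⟩ := hχ.g_eq_one_iff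
  rw [he, he, ← map_pow, map_eq_one_iff β β.injective]

lemma characteristic_ker_proj [Finite G] (hχ : Admissible χ) : (proj χ).ker.Characteristic :=
  Subgroup.characteristic_iff_comap_eq.2 fun β => by
    ext a
    exact hχ.map_g_eq_one_iff β a

/-- Kernels of the coordinate characters are mapped into kernels of the same colour. -/
lemma exists_form_map_eq_zero [Finite G] (hχ : Admissible χ)
    (β : CayleyCover χ ≃* CayleyCover χ) (c : Bool ⊕ G) (x : G) :
    ∃ y, ∀ a : CayleyCover χ, a.g = 1 → cayleyForm a.v c x = 0 →
      cayleyForm (β a).v c y = 0 := by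
  classical
  have := Fact.mk (hχ.prime_p c)
  have hb : (basis c x : CayleyCover χ) ^ p c = 1 :=
    (hχ.pow_eq_one_iff c _).2 ⟨rfl, rfl, fun d hd => by simp [basis, hd]⟩
  have hb' : β (basis c x) ^ p c = 1 := by rw [← map_pow, hb, map_one]
  obtain ⟨hg, hv, hm⟩ := (hχ.pow_eq_one_iff c _).1 hb'
  obtain ⟨y, hy⟩ : ∃ y, (β (basis c x)).m c y ≠ 0 := by
    by_contra! h
    have h1 : β (basis c x) = 1 := by
      ext d z
      · by_cases hd : d = c
        · subst hd; simp [h]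
        · simp [hm d hd]
      · simp [hv]
      · simp [hg]
    have h2 := (map_eq_one_iff β β.injective).1 h1
    have h3 := congrArg (fun a => a.m c x) h2
    simp [basis] at h3
  refine ⟨y, fun a ha h0 => ?_⟩
  -- The only nonzero coordinate of the basis element is `(c, x)`, where `a` acts with weight 1.
  have hcomm : a * basis c x = basis c x * a := by
    ext d z
    · by_cases hd : d = c
      · subst hd
        by_cases hz : z = x
        · subst hz
          simp [basis, ha, weight_zero, (weight_eq_one_iff hχ.inj _ _ _).2 h0, add_comm]
        · simp [basis, ha, weight_zero, hz]
      · simp [basis, ha, weight_zero, hd]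
    · simp [basis, ha, leftShift_one]
    · simp [basis, ha]
  -- The image of `a` commutes with an element whose coordinate at `(c, y)` is nonzero, so its
  -- weight there is 1.
  have h1 := congrArg (fun a => a.m c y) (congrArg β hcomm)
  have h2 := (hχ.map_g_eq_one_iff β a).2 ha
  simp only [map_mul, mul_m, hg, hv, h2, weight_zero, inv_one, one_mul] at h1
  rw [add_comm, add_right_cancel_iff] at h1
  rw [← weight_eq_one_iff hχ.inj]
  exact mul_right_cancel₀ hy (h1.trans (one_mul _).symm)

lemma exists_point (hχ : Admissible χ) {b b' : Bool} {x y : G} (h : (b, x) ≠ (b', y)) :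
    ∃ a : CayleyCover χ, a.g = 1 ∧ a.v b' y = 0 ∧ a.v b x ≠ 0 := by
  classical
  have := Fact.mk hχ.prime_q
  refine ⟨⟨0, Function.curry (Pi.single (b, x) 1), 1⟩, rfl, ?_, ?_⟩
  · simp [Function.curry, Pi.single_eq_of_ne h.symm]
  · simp [Function.curry]

/-- Going forth by `β` and back by `β.symm` carries the kernel of point `x` into that of some point
`z`. Distinct points are independent forms, so `z = x` and both inclusions are equalities. -/
lemma exists_map_v_eq_zero_iff [Finite G] (hχ : Admissible χ)
    (β : CayleyCover χ ≃* CayleyCover χ) (b : Bool) (x : G) :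
    ∃ y, ∀ a : CayleyCover χ, a.g = 1 → ((β a).v b y = 0 ↔ a.v b x = 0) := by
  obtain ⟨y, hy⟩ := hχ.exists_form_map_eq_zero β (Sum.inl b) x
  obtain ⟨z, hz⟩ := hχ.exists_form_map_eq_zero β.symm (Sum.inl b) y
  have key : ∀ a : CayleyCover χ, a.g = 1 → (β a).v b y = 0 → a.v b z = 0 := fun a ha h => by
    simpa [cayleyForm] using hz (β a) ((hχ.map_g_eq_one_iff β a).2 ha) h
  have hzx : z = x := by
    by_contra hne
    obtain ⟨a, ha, h0, h1⟩ := hχ.exists_point (b := b) (b' := b) (x := z) (y := x)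
      (by simpa using hne)
    exact h1 (key a ha (hy a ha h0))
  subst hzx
  exact ⟨y, fun a ha => ⟨key a ha, hy a ha⟩⟩

/-- Every automorphism of `CayleyCover χ` induces an inner automorphism on `G`. -/
theorem exists_map_g_eq_conj [Finite G] (hχ : Admissible χ)
    (β : CayleyCover χ ≃* CayleyCover χ) :
    ∃ t : G, ∀ a : CayleyCover χ, (β a).g = t * a.g * t⁻¹ := by
  classical
  choose π hπ using hχ.exists_map_v_eq_zero_iff β
  have edge : ∀ x c, π true (x * c) = π false x * c := by
    intro x c
    obtain ⟨y, hy⟩ := hχ.exists_form_map_eq_zero β (Sum.inr c) x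
    -- The edge form at `y` vanishes wherever the two image points do. Testing it on unit vectors
    -- shows that its endpoints are those points.
    have key : ∀ a : CayleyCover χ, a.g = 1 → a.v false (π false x) = 0 →
        a.v true (π true (x * c)) = 0 → a.v false y + a.v true (y * c) = 0 := by
      intro a ha h1 h2
      have ha' : (β.symm a).g = 1 := (hχ.map_g_eq_one_iff β.symm a).2 ha
      have h3 := (hπ false x _ ha').1 (by simpa using h1)
      have h4 := (hπ true (x * c) _ ha').1 (by simpa using h2)
      simpa [cayleyForm] using hy _ ha' (by simp [cayleyForm, h3, h4])
    have := Fact.mk hχ.prime_q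
    have h1 : y = π false x := by
      by_contra hne
      have := key ⟨0, Function.curry (Pi.single (false, y) 1), 1⟩ rfl
        (by simp [Function.curry, Ne.symm hne]) (by simp [Function.curry])
      simp [Function.curry] at this
    have h2 : y * c = π true (x * c) := by
      by_contra hne
      have := key ⟨0, Function.curry (Pi.single (true, y * c) 1), 1⟩ rfl
        (by simp [Function.curry]) (by simp [Function.curry, Ne.symm hne])
      simp [Function.curry] at this
    rw [← h2, h1]
  have left : ∀ x, π false x = π true 1 * x := fun x => by
    have := edge x x⁻¹
    rw [mul_inv_cancel] at this
    rw [this, inv_mul_cancel_right]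
  have conj_v : ∀ (a n : CayleyCover χ) (x : G), n.g = 1 →
      (a * n * a⁻¹).v false x = n.v false (a.g⁻¹ * x) := fun a n x hn => by
    simp [leftShift, hn]
  refine ⟨π true 1, fun a => ?_⟩
  -- Conjugation by `a` translates points by `a.g`, and conjugation by `β a` translates them by `(β
  -- a).g`; `β` intertwines the two.
  have equiv : (β a).g⁻¹ * π false a.g = π false 1 := by
    by_contra hne
    obtain ⟨n, hn, h0, h1⟩ := hχ.exists_point (b := false) (b' := false) (by simpa using hne)
    have hn' : (β.symm n).g = 1 := (hχ.map_g_eq_one_iff β.symm n).2 hn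
    have hconj : (a * β.symm n * a⁻¹).g = 1 := by simp [hn']
    apply h1
    rw [← conj_v _ _ _ hn]
    have h2 := (hπ false a.g _ hconj)
    rw [conj_v _ _ _ hn', inv_mul_cancel, ← hπ false 1 _ hn'] at h2
    simpa using h2.2 (by simpa using h0)
  rw [left, left, mul_one, inv_mul_eq_iff_eq_mul] at equiv
  rw [equiv, mul_inv_cancel_right]

end Admissible

/-! ### Choice of primes and characters -/

lemma _root_.exists_injective_hom_units_zmod {q p : ℕ} [Fact p.Prime] (hq : q.Prime)
    (hpq : p ≡ 1 [MOD q]) :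
    ∃ f : Multiplicative (ZMod q) →* (ZMod p)ˣ, Function.Injective f := by
  have := Fact.mk hq
  have hdvd : q ∣ Nat.card (ZMod p)ˣ := by
    rw [Nat.card_eq_fintype_card, ZMod.card_units]
    exact (Nat.modEq_iff_dvd' (Fact.out : p.Prime).one_le).1 hpq.symm
  obtain ⟨w, hw⟩ := exists_prime_orderOf_dvd_card' q hdvd
  have h0 : zmultiplesHom (Additive (ZMod p)ˣ) (Additive.ofMul w) (q : ℤ) = 0 := by
    rw [zmultiplesHom_apply, natCast_zsmul, ← ofMul_pow, ← hw, pow_orderOf_eq_one, ofMul_one]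
  refine ⟨AddMonoidHom.toMultiplicativeLeft (ZMod.lift q ⟨_, h0⟩), ?_⟩
  have : Function.Injective (ZMod.lift q ⟨_, h0⟩) := by
    rw [ZMod.lift_injective]
    intro n hn
    rw [ZMod.intCast_zmod_eq_zero_iff_dvd, ← hw]
    rw [zmultiplesHom_apply, ← ofMul_zpow, ofMul_eq_zero] at hn
    exact orderOf_dvd_iff_zpow_eq_one.2 hn
  exact this

/-- Take a prime `q` above the order of `G`, then by Dirichlet distinct primes above `q` congruent
to 1 modulo `q`. Size gives coprimality, and the congruence gives faithful characters. -/
lemma exists_admissible (G : Type u) [Group G] [Finite G] :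
    ∃ (q : ℕ) (p : Bool ⊕ G → ℕ) (χ : ∀ c, Multiplicative (ZMod q) →* (ZMod (p c))ˣ),
      Admissible χ := by
  have hcard : 0 < Nat.card G := Nat.card_pos
  obtain ⟨q, hq, hqp⟩ := Nat.exists_infinite_primes (Nat.card G + 1)
  have hcop : ∀ r : ℕ, r.Prime → Nat.card G < r → r.Coprime (Nat.card G) := fun r hr h =>
    Nat.coprime_of_lt_prime hcard.ne' h hr
  have hinf : {r : ℕ | r.Prime ∧ r ≡ 1 [MOD q] ∧ q < r}.Infinite := by
    rw [Set.infinite_iff_exists_gt]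
    intro n
    obtain ⟨r, hr, hlt, hmod⟩ := Nat.exists_prime_gt_modEq_one (max n q) hqp.ne_zero
    exact ⟨r, ⟨hr, hmod, (le_max_right _ _).trans_lt hlt⟩, (le_max_left _ _).trans_lt hlt⟩
  have := hinf.to_subtype
  let f : (Bool ⊕ G) ↪ {r : ℕ | r.Prime ∧ r ≡ 1 [MOD q] ∧ q < r} :=
    ((Finite.equivFin _).toEmbedding.trans Fin.valEmbedding).trans (Infinite.natEmbedding _)
  have hχ : ∀ c, ∃ χ : Multiplicative (ZMod q) →* (ZMod (f c : ℕ))ˣ, Function.Injective χ :=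
    fun c => by
      have := Fact.mk (f c).2.1
      exact exists_injective_hom_units_zmod hqp (f c).2.2.1
  choose χ hχ using hχ
  exact ⟨q, fun c => f c, χ, hχ, hqp, fun c => (f c).2.1, Subtype.val_injective.comp f.injective,
    fun c => (f c).2.2.2.ne', hcop q hqp hq, fun c => hcop _ (f c).2.1 (by
      have := (f c).2.2.2; omega)⟩

end CayleyCover

/-- Every finite group `G` is a split quotient of a finite group `H` by a characteristic subgroup
such that all automorphisms of `H` induce inner automorphisms of `G`. -/
theorem exists_split_extension_inducing_inner (G : Type u) [Group G] [Finite G] :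
    ∃ (H : Type u) (_ : Group H) (_ : Finite H) (π : H →* G) (s : G →* H),
      (∀ x, π (s x) = x) ∧ π.ker.Characteristic ∧
        ∀ β : H ≃* H, ∃ t : G, ∀ h, π (β h) = t * π h * t⁻¹ := by
  obtain ⟨q, p, χ, hχ⟩ := CayleyCover.exists_admissible G
  have : NeZero q := ⟨hχ.prime_q.ne_zero⟩
  have : ∀ c, NeZero (p c) := fun c => ⟨(hχ.prime_p c).ne_zero⟩
  exact ⟨CayleyCover χ, inferInstance, inferInstance, CayleyCover.proj χ,
    CayleyCover.complement χ, fun _ => rfl, hχ.characteristic_ker_proj, hχ.exists_map_g_eq_conj⟩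

theorem mainTheorem1 (G : Type u) [Group G] [Finite G] (α : G ≃* G) :
    List.TFAE [
      IsInnerAut α,
      ∀ (H : Type u) [Group H] [Finite H] (ι : G →* H), Function.Injective ι →
        ExtendsAlong α ι,
      ∀ (K : Type u) [Group K] [Finite K] (N : Subgroup K) [N.Characteristic]
        (φ : K ⧸ N ≃* G), LiftsAlong α N φ] := by
  tfae_have 1 → 2 := by
    rintro ⟨g, hg⟩ H _ _ ι -
    exact ⟨MulAut.conj (ι g), fun x => by simp [hg]⟩
  tfae_have 1 → 3 := by
    rintro ⟨g, hg⟩ K _ _ N _ φ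
    obtain ⟨k, hk⟩ := QuotientGroup.mk_surjective (φ.symm g)
    have hk' : φ (QuotientGroup.mk k) = g := by rw [hk, φ.apply_symm_apply]
    exact ⟨MulAut.conj k, fun x => by simp [hg, hk']⟩
  obtain ⟨H, _, _, π, s, hs, hchar, hinn⟩ := exists_split_extension_inducing_inner G
  tfae_have 2 → 1 := by
    intro h
    obtain ⟨β, hβ⟩ := h H s (Function.LeftInverse.injective hs)
    obtain ⟨t, ht⟩ := hinn β
    refine ⟨t, fun x => ?_⟩
    have := ht (s x)
    rwa [hβ, hs, hs] at this
  tfae_have 3 → 1 := by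
    intro h
    obtain ⟨β, hβ⟩ := h H π.ker
      (QuotientGroup.quotientKerEquivOfSurjective π (Function.RightInverse.surjective hs))
    obtain ⟨t, ht⟩ := hinn β
    refine ⟨t, fun x => ?_⟩
    have h1 : π (β (s x)) = α (π (s x)) := hβ (s x)
    rw [ht, hs] at h1
    exact h1.symm
  tfae_finish
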